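/- A bipartite $(r,t)$-Ruzsa–Szemerédi graph with $n$ vertices on each side is a bipartite graph whose edge set is partitioned into $t\ge 1$ induced matchings $M_1,\dots,M_t$, each with exactly $r$ edges. Given such a graph $R$ and $p\in(0,1]$, let $G(R,p)$ be the following stochastic graph on $4n$ vertices. Its base graph is $R$ together with one additional vertex and one exterior edge for each of the $2n$ vertices of $R$. In the realization $\mathcal G^\star$, the edges of $R$ are realized independently, each with probability $p$; a matching $M^*$ is chosen from $M_1,\dots,M_t$ uniformly at random, independently of the edges of $R$, and exactly the exterior edges at the vertices of $R$ that do not belong to $M^*$ are realized. A family of stochastic graphs $G_n=(V_n,E_n)$ is mildly correlated if there is a constant $K$ such that for every $n$ the edge set $E_n$ can be partitioned into $E_1$ and $E_2$ with $|E_2|\le K|V_n|$ such that for all $S_1\subseteq E_1$ and $S_2\subseteq E_2$, $$\Pr\Big[\bigcap_{e\in S_1}\{e\in\mathcal G^\star\}\Big]=\prod_{e\in S_1}\Pr[e\in\mathcal G^\star]\quad\text{and}\quad \Pr\Big[\bigcap_{e\in S_1}\{e\in\mathcal G^\star\}\,\Big|\,\bigcap_{e\in S_2}\{e\in\mathcal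 G^\star\}\Big]=\prod_{e\in S_1}\Pr[e\in\mathcal G^\star],$$ the latter whenever the conditioning event has positive probability. A (randomized) non-adaptive algorithm for vertex cover on a stochastic graph knows the base graph and the law of $\mathcal G^\star$. Using randomness independent of $\mathcal G^\star$, it fixes a set $Q$ of edges to query, learns which edges of $Q$ are realized, and outputs a set $S$ of vertices that is almost surely a vertex cover of $\mathcal G^\star$. Its number of queries is $\mathbb E|Q|$. **Theorem.** For every $\epsilon>0$ there are $p\in(0,1]$ and bipartite Ruzsa–Szemerédi graphs $R_n$ with $n$ vertices on each side ($n=0,1,2,\dots$), where the parameters $r_n,t_n$ may depend on $n$, such that the stochastic graphs $G_n=G(R_n,p)$ have the following properties. 1. Every edge of every $G_n$ has positive realization probability. 2. The family $(G_n)$ is mildly correlated. 3. For every constant $C$ there is a function $\eta(n)\to 0$ such that for every $n$ and every non-adaptive algorithm on $G_n$ that makes at most $Cn$ queries, the output $S$ satisfies $$\Pr\big[\,|S|\ge (3/2-\epsilon)\cdot|\mathrm{MVC}(\mathcal G_n^\star)|\,\big]\ge 1-\eta(n),$$ where $\mathrm{MVC}(\mathcal G_n^\star)$ is a minimum vertex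 cover of the realized graph. -/

import Mathlib

open scoped ENNReal NNReal Topology
open Filter

noncomputable section

/-! ### Stochastic graphs -/

/-- A stochastic graph on the vertex set `V`: a known base graph together with the law of the
random subgraph of it that is realized. -/
structure StochasticGraph (V : Type) where
  graph : SimpleGraph V
  law : PMF (SimpleGraph V)
  le_graph : ∀ H ∈ law.support, H ≤ graph

namespace StochasticGraph

variable {V : Type}

/-- The probability that all edges of `S` are realized. -/
def probRealized (G : StochasticGraph V) (S : Finset (Sym2 V)) : ℝ≥0∞ :=
  G.law.toOuterMeasure {H | ∀ e ∈ S, e ∈ H.edgeSet}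

/-- The realization probability `p_e` of an edge. -/
def edgeProb (G : StochasticGraph V) (e : Sym2 V) : ℝ≥0∞ :=
  G.law.toOuterMeasure {H | e ∈ H.edgeSet}

/-- `G` is mildly correlated with constant `K`: its edges split into `E₁` and `E₂`, where the edges
of `E₁` are realized independently from each other and from those of `E₂`, and `|E₂| ≤ K |V|`.
The conditional probability of "all of `S₁` is realized" given "all of `S₂` is realized" is required
to be the product whenever the conditioning event has positive probability. -/
def MildlyCorrelated [Fintype V] (G : StochasticGraph V) (K : ℕ) : Prop :=
  open Classical in
  ∃ E₁ E₂ : Finset (Sym2 V),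
    (E₁ : Set (Sym2 V)) ∪ (E₂ : Set (Sym2 V)) = G.graph.edgeSet ∧
    Disjoint E₁ E₂ ∧
    (∀ S₁ ⊆ E₁, G.probRealized S₁ = ∏ e ∈ S₁, G.edgeProb e) ∧
    (∀ S₁ ⊆ E₁, ∀ S₂ ⊆ E₂, G.probRealized S₂ ≠ 0 →
      G.probRealized (S₁ ∪ S₂) / G.probRealized S₂ = ∏ e ∈ S₁, G.edgeProb e) ∧
    E₂.card ≤ K * Fintype.card V

end StochasticGraph

/-! ### Non-adaptive algorithms -/

/-- A deterministic non-adaptive algorithm on the vertex set `V`: it fixes all its edge queries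
in advance and computes its output from the set of those queried edges that are realized. -/
structure NonAdaptiveAlgorithm (V : Type) where
  queries : Finset (Sym2 V)
  output : Set (Sym2 V) → Finset V

/-- The output of the algorithm when the realized graph is `H`. -/
def NonAdaptiveAlgorithm.run {V : Type} (a : NonAdaptiveAlgorithm V) (H : SimpleGraph V) :
    Finset V :=
  a.output {e | e ∈ a.queries ∧ e ∈ H.edgeSet}

/-- A randomized non-adaptive algorithm: a random choice, made before anything is observed, of a
deterministic one. -/
abbrev RandomizedNonAdaptiveAlgorithm (V : Type) := PMF (NonAdaptiveAlgorithm V)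

namespace RandomizedNonAdaptiveAlgorithm

variable {V : Type}

/-- The expected number of queries. -/
def expectedQueries (A : RandomizedNonAdaptiveAlgorithm V) : ℝ≥0∞ :=
  ∑' a, A a * (a.queries.card : ℝ≥0∞)

/-- The algorithm outputs a vertex cover of the realized graph (with probability one). -/
def SolvesVertexCover (A : RandomizedNonAdaptiveAlgorithm V) (G : StochasticGraph V) : Prop :=
  ∀ a ∈ A.support, ∀ H ∈ G.law.support, H.IsVertexCover (a.run H : Set V)

/-- The probability, over the algorithm's randomness and the independent realization of `G`, that
the output has size at least `c` times that of a minimum vertex cover of the realized graph. -/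
def probRatioAtLeast (A : RandomizedNonAdaptiveAlgorithm V) (G : StochasticGraph V) (c : ℝ) :
    ℝ≥0∞ :=
  (A.bind fun a => G.law.map fun H => (a, H)).toOuterMeasure
    {x | c * (x.2.vertexCoverNum.toNat : ℝ) ≤ ((x.1.run x.2).card : ℝ)}

end RandomizedNonAdaptiveAlgorithm

/-! ### Ruzsa–Szemerédi graphs and the construction -/

/-- A bipartite `(r, t)`-Ruzsa–Szemerédi graph with `n` vertices on each side: the edge set is
partitioned into `t` induced matchings with `r` edges each. -/
structure RuzsaSzemerediGraph (n r t : ℕ) where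
  graph : SimpleGraph (Fin n ⊕ Fin n)
  bipartite : graph ≤ completeBipartiteGraph (Fin n) (Fin n)
  matching : Fin t → graph.Subgraph
  isMatching : ∀ i, (matching i).IsMatching
  isInduced : ∀ i, (matching i).IsInduced
  card_matching : ∀ i, (matching i).edgeSet.ncard = r
  disjoint_matching : ∀ i j, i ≠ j → Disjoint (matching i).edgeSet (matching j).edgeSet
  iUnion_matching : ⋃ i, (matching i).edgeSet = graph.edgeSet

/-- The law of the random subgraph of `G` containing every edge of `G` independently with
probability `p`: a set `S` of edges has probability `p ^ |S| * (1 - p) ^ (|E| - |S|)`. -/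
def bernoulliSubgraph {W : Type} [Fintype W] (G : SimpleGraph W) (p : ℝ≥0) (hp : p ≤ 1) :
    PMF (SimpleGraph W) :=
  open Classical in
  PMF.map (fun S : Finset (Sym2 W) => SimpleGraph.fromEdgeSet (S : Set (Sym2 W)))
  (PMF.ofFinset
    (fun S : Finset (Sym2 W) => if S ⊆ G.edgeFinset then
      (p : ℝ≥0∞) ^ S.card * (1 - (p : ℝ≥0∞)) ^ (G.edgeFinset.card - S.card) else 0)
    G.edgeFinset.powerset
    (by
      rw [Finset.sum_congr rfl (fun S hS => if_pos (Finset.mem_powerset.mp hS)),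
        Finset.sum_pow_mul_eq_add_pow, add_tsub_cancel_of_le (by exact_mod_cast hp), one_pow])
    (fun S hS => if_neg (fun h => hS (Finset.mem_powerset.mpr h))))

theorem le_of_mem_support_bernoulliSubgraph {W : Type} [Fintype W] {G : SimpleGraph W} {p : ℝ≥0}
    {hp : p ≤ 1} {K : SimpleGraph W} (hK : K ∈ (bernoulliSubgraph G p hp).support) : K ≤ G := by
  classical
  rw [bernoulliSubgraph, PMF.mem_support_map_iff] at hK
  obtain ⟨S, hS, rfl⟩ := hK
  have hS' := ((PMF.mem_support_ofFinset_iff _ _ S).mp hS).1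
  rw [Finset.mem_powerset] at hS'
  intro v w h
  rw [SimpleGraph.fromEdgeSet_adj] at h
  simpa using hS' h.1

/-- The graph on `W ⊕ W` consisting of a copy of `K` on the core vertices `inl w` and, for each
`w ∈ X`, the exterior edge joining `inl w` to its own additional vertex `inr w`. -/
def withExterior {W : Type} (K : SimpleGraph W) (X : Set W) : SimpleGraph (W ⊕ W) where
  Adj
    | .inl u, .inl v => K.Adj u v
    | .inl u, .inr v => u = v ∧ u ∈ X
    | .inr u, .inl v => u = v ∧ u ∈ X
    | .inr _, .inr _ => False
  symm := ⟨by
    rintro (u | u) (v | v) h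
    · exact SimpleGraph.Adj.symm h
    · exact ⟨h.1.symm, h.1 ▸ h.2⟩
    · exact ⟨h.1.symm, h.1 ▸ h.2⟩
    · exact h⟩
  loopless := ⟨by
    rintro (u | u) h
    · exact SimpleGraph.Adj.ne h rfl
    · exact h⟩

theorem withExterior_mono {W : Type} {K L : SimpleGraph W} (h : K ≤ L) {X Y : Set W} (hX : X ⊆ Y) :
    withExterior K X ≤ withExterior L Y := by
  rintro (u | u) (v | v) hu
  · exact h hu
  · exact ⟨hu.1, hX hu.2⟩
  · exact ⟨hu.1, hX hu.2⟩
  · exact hu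

/-- The stochastic graph built from a Ruzsa–Szemerédi graph `R`. Its base graph is `R` with one
exterior edge attached at each vertex. The edges of `R` are realized independently with
probability `p`; one of the `t` induced matchings, `M*`, is chosen uniformly at random, independently
of these, and exactly the exterior edges at the vertices that are not in `M*` are realized. -/
def RuzsaSzemerediGraph.toStochasticGraph {n r t : ℕ} [NeZero t] (R : RuzsaSzemerediGraph n r t)
    (p : ℝ≥0) (hp : p ≤ 1) : StochasticGraph ((Fin n ⊕ Fin n) ⊕ (Fin n ⊕ Fin n)) where
  graph := withExterior R.graph Set.univ
  law := (PMF.uniformOfFintype (Fin t)).bind fun i =>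
    (bernoulliSubgraph R.graph p hp).map fun K => withExterior K (R.matching i).vertsᶜ
  le_graph := by
    intro H hH
    rw [PMF.mem_support_bind_iff] at hH
    obtain ⟨i, -, hH⟩ := hH
    rw [PMF.mem_support_map_iff] at hH
    obtain ⟨K, hK, rfl⟩ := hH
    exact withExterior_mono (le_of_mem_support_bernoulliSubgraph hK) (Set.subset_univ _)

end

/-!
Given the matching `M*`, the realized graph consists of a pendant edge at each of the
`x = 2 (n - r)` core vertices outside of `M*`, of the realized edges of `M*`, and of core edges that
meet the vertices outside of `M*`, because `M*` is induced. So it has a vertex cover of size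
`x` plus the number of realized edges of `M*`, which is close to `x` when `p` is small
(`vertexCoverNum_withExterior_le`). A non-adaptive algorithm can learn `M*`, but an edge of
`M*` that was not queried may or may not be realized without changing what is observed, so the output
has to cover it; together with the pendant edges, this forces at least `x + r` vertices up to the
number of queried edges of `M*` (`ncard_compl_verts_add_le_card_run`). For `r` near `n / 2` both `x`
and `2 r` are near `n`, and the ratio is near `3 / 2`.

Both errors are small with high probability. The `t` matchings are disjoint and `M*` is uniform, so
on average only `|Q| / t ≤ C n / t` of its edges are queried, and Markov's inequality suffices once
`t → ∞` (`sum_inv_mul_ite_lt_ncard_queries_le`). More than `n / k` of the at most `n` edges of `M*`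
are realized with probability at most `2 ^ n * p ^ (n / k)`, by a union bound; this is `2 ^ (-n)` for
`p = 4 ^ (-k)` (`bernoulliSubgraph_toOuterMeasure_le_ncard_inter`).

Since `t` may grow arbitrarily slowly, the Boolean cube provides the Ruzsa–Szemerédi graphs
(`exists_ruzsaSzemerediGraph`): on `{0,1}^T` on both sides, the `j`-th matching joins `x` with
`x j = 0` to the vector obtained by negating all its coordinates but `j`. An edge of another
matching has exactly one end with `i`-th coordinate `0`, so the matchings are induced. Disjoint
copies of the cube fill up `n` vertices, and leaving out a `1 / T` fraction of the copies from each
matching makes every vertex miss some matching, which gives each exterior edge positive probability.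
-/

/-! ### Random subgraphs and mild correlation -/

theorem PMF.toOuterMeasure_le_one {α : Type*} (q : PMF α) (s : Set α) : q.toOuterMeasure s ≤ 1 :=
  (MeasureTheory.measure_mono (Set.subset_univ s)).trans
    ((PMF.toOuterMeasure_apply_eq_one_iff q _).2 (Set.subset_univ _)).le

/-- In a Bernoulli random subgraph, a given set `U` of edges is present with probability
`p ^ |U|`. -/
theorem bernoulliSubgraph_toOuterMeasure_superset {W : Type} [Fintype W] (G : SimpleGraph W)
    (p : ℝ≥0) (hp : p ≤ 1) (U : Finset (Sym2 W)) (hU : ∀ e ∈ U, e ∈ G.edgeSet) :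
    (bernoulliSubgraph G p hp).toOuterMeasure {K | ∀ e ∈ U, e ∈ K.edgeSet} =
      (p : ℝ≥0∞) ^ U.card := by
  classical
  have hUE : U ⊆ G.edgeFinset := fun e he => by simpa using hU e he
  rw [bernoulliSubgraph, PMF.toOuterMeasure_map_apply, PMF.toOuterMeasure_apply,
    tsum_eq_sum (s := Finset.Icc U G.edgeFinset)]
  · have hval : ∀ S ∈ Finset.Icc U G.edgeFinset,
        Set.indicator ((fun S : Finset (Sym2 W) => SimpleGraph.fromEdgeSet (S : Set (Sym2 W))) ⁻¹'
          {K | ∀ e ∈ U, e ∈ K.edgeSet}) (fun S : Finset (Sym2 W) => if S ⊆ G.edgeFinset then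
          (p : ℝ≥0∞) ^ S.card * (1 - (p : ℝ≥0∞)) ^ (G.edgeFinset.card - S.card) else 0) S =
        (p : ℝ≥0∞) ^ S.card * (1 - (p : ℝ≥0∞)) ^ (G.edgeFinset.card - S.card) := by
      intro S hS
      rw [Finset.mem_Icc] at hS
      rw [Set.indicator_of_mem, if_pos hS.2]
      intro e he
      rw [SimpleGraph.edgeSet_fromEdgeSet]
      exact ⟨hS.1 he, G.not_isDiag_of_mem_edgeSet (hU e he)⟩
    have hsum := Finset.sum_pow_mul_eq_add_pow (p : ℝ≥0∞) (1 - p) (G.edgeFinset \ U)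
    rw [add_tsub_cancel_of_le (by exact_mod_cast hp), one_pow] at hsum
    refine (Finset.sum_congr rfl fun S hS => ?_).trans
      ((Finset.sum_congr rfl hval).trans ?_)
    · simp only [Set.indicator, PMF.ofFinset_apply]
    · rw [Finset.Icc_eq_image_powerset hUE, Finset.sum_image]
      · refine Eq.trans ?_ ((congrArg ((p : ℝ≥0∞) ^ U.card * ·) hsum).trans (mul_one _))
        rw [Finset.mul_sum]
        refine Finset.sum_congr rfl fun S hS => ?_
        rw [Finset.mem_powerset, Finset.subset_sdiff] at hS
        rw [Finset.card_union_of_disjoint hS.2.symm, Finset.card_sdiff_of_subset hUE, pow_add,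
          mul_assoc, Nat.sub_add_eq]
      · intro S hS T hT hST
        simp only [Finset.coe_powerset, Set.mem_preimage, Set.mem_powerset_iff,
          Finset.coe_subset, Finset.subset_sdiff] at hS hT
        have := congrArg (· \ U) hST
        simpa [Finset.union_sdiff_distrib, Finset.sdiff_eq_self_of_disjoint hS.2,
          Finset.sdiff_eq_self_of_disjoint hT.2] using this
  · intro S hS
    rw [Set.indicator_apply_eq_zero]
    intro hS'
    rw [PMF.ofFinset_apply, if_neg]
    intro hSE
    refine hS (Finset.mem_Icc.2 ⟨fun e he => ?_, fun e he => ?_⟩)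
    · have := hS' e he
      rw [SimpleGraph.edgeSet_fromEdgeSet] at this
      exact this.1
    · simpa using hSE he

/-- For `0 < p < 1`, every subgraph of `G` is a possible value of the random subgraph. -/
theorem mem_support_bernoulliSubgraph_of_le {W : Type} [Fintype W] {G K : SimpleGraph W}
    {p : ℝ≥0} (hp : p ≤ 1) (hp0 : 0 < p) (hp1 : p < 1) (hK : K ≤ G) :
    K ∈ (bernoulliSubgraph G p hp).support := by
  classical
  rw [bernoulliSubgraph, PMF.mem_support_map_iff]
  refine ⟨K.edgeFinset, ?_, by simp⟩
  have hsub : K.edgeFinset ⊆ G.edgeFinset := SimpleGraph.edgeFinset_subset_edgeFinset.2 hK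
  rw [PMF.mem_support_ofFinset_iff]
  have h0 : (p : ℝ≥0∞) ≠ 0 := by simpa using hp0.ne'
  have h1 : 1 - (p : ℝ≥0∞) ≠ 0 := by
    rw [Ne, tsub_eq_zero_iff_le, not_le]
    exact_mod_cast hp1
  have hsub' : ∀ e ∈ K.edgeSet, e ∈ G.edgeSet := fun e he => SimpleGraph.edgeSet_mono hK he
  refine ⟨by rw [Finset.mem_powerset]; intro e he; simp at he ⊢; exact hsub' e he, ?_⟩
  rw [if_pos (by intro e he; simp at he ⊢; exact hsub' e he)]
  exact mul_ne_zero (pow_ne_zero _ h0) (pow_ne_zero _ h1)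

theorem inl_mem_edgeSet_withExterior {W : Type} {K : SimpleGraph W} {X : Set W} (e : Sym2 W) :
    e.map Sum.inl ∈ (withExterior K X).edgeSet ↔ e ∈ K.edgeSet := by
  induction e with
  | _ u v => rfl

/-- The exterior edge at the core vertex `w`. -/
def exteriorEdge {W : Type} (w : W) : Sym2 (W ⊕ W) := s(Sum.inl w, Sum.inr w)

theorem exteriorEdge_mem_edgeSet_withExterior {W : Type} {K : SimpleGraph W} {X : Set W} (w : W) :
    exteriorEdge w ∈ (withExterior K X).edgeSet ↔ w ∈ X :=
  ⟨fun h => h.2, fun h => ⟨rfl, h⟩⟩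

theorem exteriorEdge_injective {W : Type} :
    Function.Injective (exteriorEdge : W → Sym2 (W ⊕ W)) := by
  intro v w h
  simpa [exteriorEdge] using h

theorem map_inl_ne_exteriorEdge {W : Type} (e : Sym2 W) (w : W) :
    e.map Sum.inl ≠ exteriorEdge w := by
  induction e with
  | _ u v => simp [exteriorEdge]

theorem mem_edgeSet_withExterior {W : Type} {K : SimpleGraph W} {X : Set W} {e : Sym2 (W ⊕ W)} :
    e ∈ (withExterior K X).edgeSet ↔
      (∃ f ∈ K.edgeSet, f.map Sum.inl = e) ∨ ∃ w ∈ X, exteriorEdge w = e := by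
  constructor
  · induction e with
    | _ u v =>
      rcases u with u | u <;> rcases v with v | v <;> intro h
      · exact Or.inl ⟨s(u, v), h, rfl⟩
      · obtain ⟨rfl, hu⟩ : u = v ∧ u ∈ X := h
        exact Or.inr ⟨u, hu, rfl⟩
      · obtain ⟨rfl, hu⟩ : u = v ∧ u ∈ X := h
        exact Or.inr ⟨u, hu, Sym2.eq_swap⟩
      · exact h.elim
  · rintro (⟨f, hf, rfl⟩ | ⟨w, hw, rfl⟩)
    · exact (inl_mem_edgeSet_withExterior f).2 hf
    · exact (exteriorEdge_mem_edgeSet_withExterior w).2 hw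

namespace RuzsaSzemerediGraph

variable {n r t : ℕ} [NeZero t] (R : RuzsaSzemerediGraph n r t) (p : ℝ≥0) (hp : p ≤ 1)

theorem toOuterMeasure_law (s : Set (SimpleGraph ((Fin n ⊕ Fin n) ⊕ (Fin n ⊕ Fin n)))) :
    (R.toStochasticGraph p hp).law.toOuterMeasure s =
      ∑ i, (t : ℝ≥0∞)⁻¹ * (bernoulliSubgraph R.graph p hp).toOuterMeasure
        {K | withExterior K (R.matching i).vertsᶜ ∈ s} := by
  simp only [toStochasticGraph, PMF.toOuterMeasure_bind_apply, PMF.toOuterMeasure_map_apply,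
    PMF.uniformOfFintype_apply, Fintype.card_fin, tsum_fintype]
  rfl

open Classical in
/-- The edges of `R` are realized independently of each other and of the exterior edges. -/
theorem probRealized_core_union_exterior (U : Finset (Sym2 (Fin n ⊕ Fin n)))
    (hU : ∀ e ∈ U, e ∈ R.graph.edgeSet) (Y : Finset (Fin n ⊕ Fin n)) :
    (R.toStochasticGraph p hp).probRealized
        (U.image (Sym2.map Sum.inl) ∪ Y.image exteriorEdge) =
      (p : ℝ≥0∞) ^ U.card *
        ∑ i, (t : ℝ≥0∞)⁻¹ * if ∀ w ∈ Y, w ∉ (R.matching i).verts then 1 else 0 := by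
  rw [StochasticGraph.probRealized, toOuterMeasure_law, Finset.mul_sum]
  refine Finset.sum_congr rfl fun i _ => ?_
  have hset : {K : SimpleGraph (Fin n ⊕ Fin n) | withExterior K (R.matching i).vertsᶜ ∈
      {H : SimpleGraph ((Fin n ⊕ Fin n) ⊕ (Fin n ⊕ Fin n)) |
        ∀ e ∈ U.image (Sym2.map Sum.inl) ∪ Y.image exteriorEdge, e ∈ H.edgeSet}} =
      {K | (∀ e ∈ U, e ∈ K.edgeSet) ∧ ∀ w ∈ Y, w ∉ (R.matching i).verts} := by
    ext K
    simp only [Set.mem_ofPred_eq, Finset.mem_union, Finset.mem_image, or_imp, forall_and,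
      forall_exists_index, and_imp, forall_apply_eq_imp_iff₂, inl_mem_edgeSet_withExterior,
      exteriorEdge_mem_edgeSet_withExterior, Set.mem_compl_iff]
  rw [hset]
  by_cases h : ∀ w ∈ Y, w ∉ (R.matching i).verts
  · simp only [if_pos h, mul_one, and_iff_left h]
    rw [bernoulliSubgraph_toOuterMeasure_superset _ _ _ _ hU, mul_comm]
  · simp only [h, and_false, if_false, mul_zero]
    exact mul_eq_zero_of_right _ (MeasureTheory.measure_empty
      (μ := (bernoulliSubgraph R.graph p hp).toOuterMeasure))

theorem sum_inv_card_eq_one : ∑ _i : Fin t, (t : ℝ≥0∞)⁻¹ = 1 := by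
  rw [Finset.sum_const, Finset.card_univ, Fintype.card_fin, nsmul_eq_mul,
    ENNReal.mul_inv_cancel (by exact_mod_cast NeZero.ne t) (ENNReal.natCast_ne_top t)]

open Classical in
theorem probRealized_core (U : Finset (Sym2 (Fin n ⊕ Fin n)))
    (hU : ∀ e ∈ U, e ∈ R.graph.edgeSet) :
    (R.toStochasticGraph p hp).probRealized (U.image (Sym2.map Sum.inl)) =
      (p : ℝ≥0∞) ^ U.card := by
  have h := probRealized_core_union_exterior R p hp U hU ∅
  simpa [-Finset.sum_const, sum_inv_card_eq_one] using h

theorem edgeProb_core {e : Sym2 (Fin n ⊕ Fin n)} (he : e ∈ R.graph.edgeSet) :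
    (R.toStochasticGraph p hp).edgeProb (e.map Sum.inl) = p := by
  have h := probRealized_core R p hp {e} (by simpa using he)
  simpa [StochasticGraph.probRealized, StochasticGraph.edgeProb] using h

/-- An exterior edge is realized with positive probability as soon as some matching misses its
core vertex. -/
theorem edgeProb_exteriorEdge_pos {w : Fin n ⊕ Fin n} (hw : ∃ i, w ∉ (R.matching i).verts) :
    0 < (R.toStochasticGraph p hp).edgeProb (exteriorEdge w) := by
  classical
  obtain ⟨i, hi⟩ := hw
  have h := probRealized_core_union_exterior R p hp ∅ (by simp) {w}
  have h' : (R.toStochasticGraph p hp).edgeProb (exteriorEdge w) =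
      ∑ i, (t : ℝ≥0∞)⁻¹ * if w ∉ (R.matching i).verts then 1 else 0 := by
    simpa [StochasticGraph.probRealized, StochasticGraph.edgeProb] using h
  rw [h']
  refine lt_of_lt_of_le ?_ (Finset.single_le_sum
    (f := fun i => (t : ℝ≥0∞)⁻¹ * if w ∉ (R.matching i).verts then (1 : ℝ≥0∞) else 0)
    (fun _ _ => zero_le) (Finset.mem_univ i))
  simp [hi]

theorem edgeProb_pos (hp0 : 0 < p) (hR : ∀ w, ∃ i, w ∉ (R.matching i).verts)
    {e : Sym2 ((Fin n ⊕ Fin n) ⊕ (Fin n ⊕ Fin n))}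
    (he : e ∈ (R.toStochasticGraph p hp).graph.edgeSet) :
    0 < (R.toStochasticGraph p hp).edgeProb e := by
  obtain ⟨f, hf, rfl⟩ | ⟨w, -, rfl⟩ := mem_edgeSet_withExterior.1 he
  · rw [edgeProb_core R p hp hf]
    exact_mod_cast hp0
  · exact edgeProb_exteriorEdge_pos R p hp (hR w)

theorem mildlyCorrelated : (R.toStochasticGraph p hp).MildlyCorrelated 1 := by
  classical
  have hinj : Function.Injective (Sym2.map (Sum.inl : Fin n ⊕ Fin n →
      (Fin n ⊕ Fin n) ⊕ (Fin n ⊕ Fin n))) :=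
    Sym2.map.injective Sum.inl_injective
  have hprod : ∀ U : Finset (Sym2 (Fin n ⊕ Fin n)), (∀ e ∈ U, e ∈ R.graph.edgeSet) →
      ∏ e ∈ U.image (Sym2.map (Sum.inl : Fin n ⊕ Fin n → (Fin n ⊕ Fin n) ⊕ (Fin n ⊕ Fin n))),
        (R.toStochasticGraph p hp).edgeProb e =
        (p : ℝ≥0∞) ^ U.card := by
    intro U hU
    rw [Finset.prod_image hinj.injOn,
      Finset.prod_congr rfl fun e he => edgeProb_core R p hp (hU e he), Finset.prod_const]
  have hcore : ∀ S ⊆ R.graph.edgeFinset.image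
      (Sym2.map (Sum.inl : Fin n ⊕ Fin n → (Fin n ⊕ Fin n) ⊕ (Fin n ⊕ Fin n))),
      ∃ U : Finset (Sym2 (Fin n ⊕ Fin n)), (∀ e ∈ U, e ∈ R.graph.edgeSet) ∧
        S = U.image (Sym2.map Sum.inl) := by
    intro S hS
    obtain ⟨U, hU, rfl⟩ := Finset.subset_image_iff.1 hS
    exact ⟨U, fun e he => by simpa using hU he, rfl⟩
  refine ⟨R.graph.edgeFinset.image (Sym2.map Sum.inl), Finset.univ.image exteriorEdge,
    ?_, ?_, ?_, ?_, ?_⟩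
  · ext e
    refine Iff.trans ?_ mem_edgeSet_withExterior.symm
    simp
  · rw [Finset.disjoint_left]
    intro e he he'
    obtain ⟨f, -, rfl⟩ := Finset.mem_image.1 he
    obtain ⟨w, -, hw⟩ := Finset.mem_image.1 he'
    exact map_inl_ne_exteriorEdge f w hw.symm
  · intro S hS
    obtain ⟨U, hU, rfl⟩ := hcore S hS
    rw [hprod U hU, ← probRealized_core R p hp U hU]
  · intro S₁ hS₁ S₂ hS₂ h0
    obtain ⟨U, hU, rfl⟩ := hcore S₁ hS₁
    obtain ⟨Y, -, rfl⟩ := Finset.subset_image_iff.1 hS₂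
    have hY := probRealized_core_union_exterior R p hp ∅ (by simp) Y
    rw [Finset.image_empty, Finset.empty_union, Finset.card_empty, pow_zero, one_mul] at hY
    have htop : (R.toStochasticGraph p hp).probRealized (Y.image exteriorEdge) ≠ ⊤ :=
      ne_top_of_le_ne_top ENNReal.one_ne_top (PMF.toOuterMeasure_le_one _ _)
    have hUY := probRealized_core_union_exterior R p hp U hU Y
    rw [← hY] at hUY
    rw [hprod U hU]
    refine Eq.trans ?_ (ENNReal.mul_div_cancel_right h0 htop)
    rw [← hUY]
    congr!
  · rw [Finset.card_image_of_injective _ exteriorEdge_injective, Finset.card_univ,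
      Fintype.card_sum, Fintype.card_sum (α := Fin n ⊕ Fin n), Fintype.card_sum]
    omega

end RuzsaSzemerediGraph

/-! ### Vertex covers of the realized graph -/

theorem SimpleGraph.Subgraph.IsMatching.two_mul_ncard_edgeSet_le {V : Type*} [Finite V]
    {G : SimpleGraph V} {M : G.Subgraph} (hM : M.IsMatching) :
    2 * M.edgeSet.ncard ≤ M.verts.ncard := by
  classical
  have hcard : ((M.edgeSet.toFinite.toFinset).biUnion Sym2.toFinset).card =
      ∑ e ∈ M.edgeSet.toFinite.toFinset, e.toFinset.card := by
    refine Finset.card_biUnion fun e he f hf hef => ?_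
    rw [Function.onFun, Finset.disjoint_left]
    intro v hve hvf
    rw [Sym2.mem_toFinset] at hve hvf
    obtain ⟨u, rfl⟩ := hve
    obtain ⟨w, rfl⟩ := hvf
    have he' : M.Adj v u := by simpa using he
    have hf' : M.Adj v w := by simpa using hf
    exact hef (by rw [hM.eq_of_adj_left he' hf'])
  have hsub : (((M.edgeSet.toFinite.toFinset).biUnion Sym2.toFinset : Finset V) : Set V) ⊆
      M.verts := by
    intro v hv
    obtain ⟨e, he, hve⟩ := Finset.mem_biUnion.1 (Finset.mem_coe.1 hv)
    obtain ⟨u, rfl⟩ := Sym2.mem_toFinset.1 hve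
    have he' : M.Adj v u := by simpa using he
    exact he'.fst_mem
  have hle := Set.ncard_le_ncard hsub M.verts.toFinite
  rw [Set.ncard_coe_finset, hcard, Finset.sum_congr rfl fun e he =>
    Sym2.card_toFinset_of_not_isDiag e
      (G.not_isDiag_of_mem_edgeSet (M.edgeSet_subset (by simpa using he))),
    Finset.sum_const, smul_eq_mul, ← Set.ncard_eq_toFinset_card] at hle
  omega

namespace RuzsaSzemerediGraph

variable {n r t : ℕ} (R : RuzsaSzemerediGraph n r t)

theorem ncard_compl_verts_add_le (i : Fin t) :
    ((R.matching i).verts)ᶜ.ncard + 2 * r ≤ 2 * n := by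
  have h := (R.isMatching i).two_mul_ncard_edgeSet_le
  rw [R.card_matching i] at h
  have h' := Set.ncard_add_ncard_compl (R.matching i).verts
  rw [Nat.card_eq_fintype_card, Fintype.card_sum, Fintype.card_fin] at h'
  omega

/-- The vertices outside the matching, together with one endpoint of each of its realized edges,
cover the realized graph, because the matching is induced. -/
theorem vertexCoverNum_withExterior_le {K : SimpleGraph (Fin n ⊕ Fin n)} (hK : K ≤ R.graph)
    (i : Fin t) :
    (withExterior K (R.matching i).vertsᶜ).vertexCoverNum.toNat ≤
      ((R.matching i).verts)ᶜ.ncard + (K.edgeSet ∩ (R.matching i).edgeSet).ncard := by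
  set c : Set ((Fin n ⊕ Fin n) ⊕ (Fin n ⊕ Fin n)) := Sum.inl '' ((R.matching i).vertsᶜ ∪
    (fun e : Sym2 (Fin n ⊕ Fin n) => e.out.1) '' (K.edgeSet ∩ (R.matching i).edgeSet)) with hc
  have hcover : (withExterior K (R.matching i).vertsᶜ).IsVertexCover c := by
    rintro (u | u) (v | v) h
    · by_cases hu : u ∈ (R.matching i).verts
      · by_cases hv : v ∈ (R.matching i).verts
        · have huv : K.Adj u v := h
          have hM : (R.matching i).Adj u v := R.isInduced i hu hv (hK huv)
          have hmem : s(u, v).out.1 ∈ (fun e : Sym2 (Fin n ⊕ Fin n) => e.out.1) ''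
              (K.edgeSet ∩ (R.matching i).edgeSet) := ⟨s(u, v), ⟨huv, hM⟩, rfl⟩
          rcases Sym2.mem_iff.1 (Sym2.out_fst_mem s(u, v)) with heq | heq
          · exact Or.inl ⟨u, Or.inr (heq ▸ hmem), rfl⟩
          · exact Or.inr ⟨v, Or.inr (heq ▸ hmem), rfl⟩
        · exact Or.inr ⟨v, Or.inl hv, rfl⟩
      · exact Or.inl ⟨u, Or.inl hu, rfl⟩
    · exact Or.inl ⟨u, Or.inl h.2, rfl⟩
    · exact Or.inr ⟨v, Or.inl (h.1 ▸ h.2), rfl⟩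
    · exact h.elim
  have h1 := hcover.vertexCoverNum_le
  rw [← c.toFinite.cast_ncard_eq] at h1
  refine (ENat.toNat_le_of_le_natCast h1).trans ?_
  rw [hc, Set.ncard_image_of_injective _ Sum.inl_injective]
  exact (Set.ncard_union_le _ _).trans (Nat.add_le_add_left (Set.ncard_image_le (Set.toFinite _)) _)

variable [NeZero t]

theorem withExterior_mem_support {p : ℝ≥0} (hp : p ≤ 1) (hp0 : 0 < p) (hp1 : p < 1)
    {K : SimpleGraph (Fin n ⊕ Fin n)} (hK : K ≤ R.graph) (i : Fin t) :
    withExterior K (R.matching i).vertsᶜ ∈ (R.toStochasticGraph p hp).law.support := by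
  simp only [toStochasticGraph]
  rw [PMF.mem_support_bind_iff]
  refine ⟨i, by simp, ?_⟩
  rw [PMF.mem_support_map_iff]
  exact ⟨K, mem_support_bernoulliSubgraph_of_le hp hp0 hp1 hK, rfl⟩

/-- An output that is always a vertex cover hits every edge of the chosen matching that was not
queried, since the observation is the same whether or not that edge is realized. -/
theorem exists_mem_run_of_not_mem_queries {p : ℝ≥0} (hp : p ≤ 1) (hp0 : 0 < p) (hp1 : p < 1)
    {a : NonAdaptiveAlgorithm ((Fin n ⊕ Fin n) ⊕ (Fin n ⊕ Fin n))}
    (ha : ∀ H ∈ (R.toStochasticGraph p hp).law.support, H.IsVertexCover (a.run H : Set _))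
    {K : SimpleGraph (Fin n ⊕ Fin n)} (hK : K ≤ R.graph) (i : Fin t)
    {e : Sym2 (Fin n ⊕ Fin n)} (he : e ∈ (R.matching i).edgeSet)
    (heq : e.map Sum.inl ∉ a.queries) :
    ∃ u ∈ e, Sum.inl u ∈ a.run (withExterior K (R.matching i).vertsᶜ) := by
  have heR : e ∈ R.graph.edgeSet := (R.matching i).edgeSet_subset he
  -- `L` is a possible core that looks like `K` to the algorithm and contains `e`.
  set L : SimpleGraph (Fin n ⊕ Fin n) := K ⊔ SimpleGraph.fromEdgeSet {e} with hL
  have hLE : ∀ f, f ∈ L.edgeSet ↔ f ∈ K.edgeSet ∨ f = e := by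
    intro f
    rw [hL, SimpleGraph.edgeSet_sup, SimpleGraph.edgeSet_fromEdgeSet]
    constructor
    · rintro (h | h)
      · exact Or.inl h
      · exact Or.inr h.1
    · rintro (h | rfl)
      · exact Or.inl h
      · exact Or.inr ⟨rfl, R.graph.not_isDiag_of_mem_edgeSet heR⟩
  have hLR : L ≤ R.graph := by
    rw [← SimpleGraph.edgeSet_subset_edgeSet]
    intro f hf
    rcases (hLE f).1 hf with h | rfl
    · exact SimpleGraph.edgeSet_mono hK h
    · exact heR
  have hrun : a.run (withExterior L (R.matching i).vertsᶜ) =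
      a.run (withExterior K (R.matching i).vertsᶜ) := by
    rw [NonAdaptiveAlgorithm.run, NonAdaptiveAlgorithm.run]
    congr 1
    ext f
    refine and_congr_right fun hf => ?_
    rw [mem_edgeSet_withExterior, mem_edgeSet_withExterior]
    refine or_congr_left (exists_congr fun f' => and_congr_left ?_)
    rintro rfl
    rw [hLE]
    refine or_iff_left ?_
    rintro rfl
    exact heq hf
  have hcov := ha _ (R.withExterior_mem_support hp hp0 hp1 hLR i)
  rw [hrun] at hcov
  have heL := (hLE e).2 (Or.inr rfl)
  induction e with
  | _ u v =>
    rcases hcov (v := Sum.inl u) (w := Sum.inl v) heL with h | h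
    · exact ⟨u, by simp, h⟩
    · exact ⟨v, by simp, h⟩

/-- The output has a vertex at each realized exterior edge and, separately, one on each edge of the
chosen matching that was not queried. -/
theorem ncard_compl_verts_add_le_card_run {p : ℝ≥0} (hp : p ≤ 1) (hp0 : 0 < p) (hp1 : p < 1)
    {a : NonAdaptiveAlgorithm ((Fin n ⊕ Fin n) ⊕ (Fin n ⊕ Fin n))}
    (ha : ∀ H ∈ (R.toStochasticGraph p hp).law.support, H.IsVertexCover (a.run H : Set _))
    {K : SimpleGraph (Fin n ⊕ Fin n)} (hK : K ≤ R.graph) (i : Fin t) :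
    ((R.matching i).verts)ᶜ.ncard + r ≤
      (a.run (withExterior K (R.matching i).vertsᶜ)).card +
        ((R.matching i).edgeSet ∩ {e | e.map Sum.inl ∈ a.queries}).ncard := by
  classical
  set S := a.run (withExterior K (R.matching i).vertsᶜ) with hS
  have hcov : (withExterior K (R.matching i).vertsᶜ).IsVertexCover (S : Set _) :=
    ha _ (R.withExterior_mem_support hp hp0 hp1 hK i)
  set D := (R.matching i).edgeSet \ {e | e.map Sum.inl ∈ a.queries} with hD
  have hhit : ∀ e : Sym2 (Fin n ⊕ Fin n), ∃ u, e ∈ D → u ∈ e ∧ Sum.inl u ∈ S := by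
    intro e
    by_cases he : e ∈ D
    · obtain ⟨u, hu, huS⟩ :=
        R.exists_mem_run_of_not_mem_queries hp hp0 hp1 ha hK i he.1 he.2
      exact ⟨u, fun _ => ⟨hu, huS⟩⟩
    · exact ⟨e.out.1, fun h => absurd h he⟩
  choose g hg using hhit
  have hginj : Set.InjOn g D := by
    intro e he f hf hef
    have h1 := (hg e he).1
    have h2 := (hg f hf).1
    rw [← hef] at h2
    obtain ⟨u, hu⟩ := h1
    obtain ⟨w, hw⟩ := h2
    have he' : (R.matching i).Adj (g e) u := by
      rw [← SimpleGraph.Subgraph.mem_edgeSet, ← hu]; exact he.1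
    have hf' : (R.matching i).Adj (g e) w := by
      rw [← SimpleGraph.Subgraph.mem_edgeSet, ← hw]; exact hf.1
    rw [hu, hw, (R.isMatching i).eq_of_adj_left he' hf']
  have hgv : g '' D ⊆ (R.matching i).verts := by
    rintro _ ⟨e, he, rfl⟩
    exact SimpleGraph.Subgraph.mem_verts_of_mem_edge he.1 (hg e he).1
  -- Both ends of an exterior edge are projected to its core vertex.
  have hsub : (R.matching i).vertsᶜ ∪ g '' D ⊆
      ((S.image (Sum.elim id id) : Finset (Fin n ⊕ Fin n)) : Set (Fin n ⊕ Fin n)) := by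
    rintro w (hw | ⟨e, he, rfl⟩)
    · have hadj : (withExterior K (R.matching i).vertsᶜ).Adj (Sum.inl w) (Sum.inr w) := ⟨rfl, hw⟩
      rw [Finset.mem_coe, Finset.mem_image]
      rcases hcov hadj with h | h
      · exact ⟨_, h, rfl⟩
      · exact ⟨_, h, rfl⟩
    · rw [Finset.mem_coe, Finset.mem_image]
      exact ⟨_, (hg e he).2, rfl⟩
  have hle := Set.ncard_le_ncard hsub (Finset.finite_toSet _)
  rw [Set.ncard_coe_finset, Set.ncard_union_eq
    (Set.disjoint_compl_left_iff_subset.2 hgv) (Set.toFinite _) (Set.toFinite _),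
    hginj.ncard_image] at hle
  have hr := Set.ncard_inter_add_ncard_sdiff_eq_ncard (R.matching i).edgeSet
    {e | e.map Sum.inl ∈ a.queries} (Set.toFinite _)
  rw [R.card_matching i, ← hD] at hr
  have hS' := Finset.card_image_le (s := S) (f := Sum.elim id id)
  omega

end RuzsaSzemerediGraph

/-! ### Ruzsa–Szemerédi graphs from the Boolean cube -/

/-- The bipartite graph on `α ⊕ β` whose edges are the pairs related by `m`. -/
def bipartiteGraphOfRel {α β : Type} (m : α → β → Prop) : SimpleGraph (α ⊕ β) where
  Adj
    | .inl a, .inr b => m a b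
    | .inr b, .inl a => m a b
    | .inl _, .inl _ => False
    | .inr _, .inr _ => False
  symm := ⟨by rintro (a | a) (b | b) h <;> exact h⟩
  loopless := ⟨by rintro (a | a) h <;> exact h⟩

theorem edgeSet_bipartiteGraphOfRel {α β : Type} (m : α → β → Prop) :
    (bipartiteGraphOfRel m).edgeSet =
      (fun x : α × β => s(Sum.inl x.1, Sum.inr x.2)) '' {x | m x.1 x.2} := by
  ext e
  induction e with
  | _ u v =>
    rcases u with u | u <;> rcases v with v | v <;> simp [bipartiteGraphOfRel]

theorem ncard_edgeSet_bipartiteGraphOfRel {α β : Type} (m : α → β → Prop) :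
    (bipartiteGraphOfRel m).edgeSet.ncard = {x : α × β | m x.1 x.2}.ncard := by
  rw [edgeSet_bipartiteGraphOfRel, Set.ncard_image_of_injective]
  rintro ⟨a, b⟩ ⟨a', b'⟩ h
  simpa using h

/-- A Ruzsa–Szemerédi graph from partial injections `m j` of `r` pairs each, such that a pair in
`m j` has its left end in the domain of `m i` and its right end in the range of `m i` only
if `i = j`. -/
def RuzsaSzemerediGraph.ofRel {n r t : ℕ} (m : Fin t → Fin n → Fin n → Prop)
    (hright : ∀ j a b b', m j a b → m j a b' → b = b')
    (hleft : ∀ j a a' b, m j a b → m j a' b → a = a')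
    (hind : ∀ i j a b a' b', m j a b → m i a b' → m i a' b → i = j)
    (hcard : ∀ j, {x : Fin n × Fin n | m j x.1 x.2}.ncard = r) : RuzsaSzemerediGraph n r t where
  graph := bipartiteGraphOfRel fun a b => ∃ j, m j a b
  bipartite := by
    rintro (a | a) (b | b) h
    · exact h.elim
    · simp
    · simp
    · exact h.elim
  matching j :=
    { verts := {v | ∃ w, (bipartiteGraphOfRel (m j)).Adj v w}
      Adj := (bipartiteGraphOfRel (m j)).Adj
      adj_sub := by rintro (a | a) (b | b) h <;> first | exact h.elim | exact ⟨j, h⟩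
      edge_vert := fun h => ⟨_, h⟩
      symm := ⟨fun _ _ h => h.symm⟩ }
  isMatching j := by
    rintro (a | a) ⟨w, hw⟩
    · refine ⟨w, hw, ?_⟩
      rintro (b | b) hb <;> rcases w with w | w
      · exact hb.elim
      · exact hb.elim
      · exact hw.elim
      · rw [hright j a b w hb hw]
    · refine ⟨w, hw, ?_⟩
      rintro (b | b) hb <;> rcases w with w | w
      · rw [hleft j b w a hb hw]
      · exact hw.elim
      · exact hb.elim
      · exact hb.elim
  isInduced i := by
    rintro (a | a) ⟨w, hw⟩ (b | b) ⟨w', hw'⟩ h <;> rcases w with w | w <;> rcases w' with w' | w'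
      <;> first | exact h.elim | exact hw.elim | exact hw'.elim | skip
    · obtain ⟨j, hj⟩ := h
      obtain rfl := hind i j a b w' w hj hw hw'
      exact hj
    · obtain ⟨j, hj⟩ := h
      obtain rfl := hind i j b a w w' hj hw' hw
      exact hj
  card_matching j := (ncard_edgeSet_bipartiteGraphOfRel (m j)).trans (hcard j)
  disjoint_matching i j hij := by
    rw [Set.disjoint_left]
    intro e
    induction e with
    | _ u v =>
      rcases u with a | a <;> rcases v with b | b <;> intro hi hj
      · exact hi
      · exact hij (hind i j a b a b hj hi hi)
      · exact hij (hind i j b a b a hj hi hi)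
      · exact hi
  iUnion_matching := by
    ext e
    rw [Set.mem_iUnion]
    induction e with
    | _ u v =>
      rcases u with a | a <;> rcases v with b | b
      · exact ⟨fun ⟨_, h⟩ => h, fun h => h.elim⟩
      · exact Iff.rfl
      · exact Iff.rfl
      · exact ⟨fun ⟨_, h⟩ => h, fun h => h.elim⟩

/-- Negates all coordinates of a Boolean vector except the coordinate `j`. -/
def flipExcept {T : ℕ} (j : Fin T) (x : Fin T → Bool) : Fin T → Bool :=
  fun i => if i = j then x i else !x i

theorem flipExcept_self {T : ℕ} (j : Fin T) (x : Fin T → Bool) : flipExcept j x j = x j := by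
  simp [flipExcept]

theorem flipExcept_of_ne {T : ℕ} {i j : Fin T} (h : i ≠ j) (x : Fin T → Bool) :
    flipExcept j x i = !x i := by
  simp [flipExcept, h]

theorem flipExcept_injective {T : ℕ} (j : Fin T) : Function.Injective (flipExcept j) := by
  have : Function.Involutive (flipExcept j) := by
    intro x
    ext i
    by_cases h : i = j <;> simp [flipExcept, h]
  exact this.injective

theorem ncard_apply_eq_false {T : ℕ} (j : Fin T) :
    {x : Fin T → Bool | x j = false}.ncard = 2 ^ (T - 1) := by
  have : {x : Fin T → Bool | x j = false} =
      (Fintype.piFinset fun i => if i = j then {false} else Finset.univ : Set (Fin T → Bool)) := by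
    ext x
    simp only [Set.mem_ofPred_eq, Finset.mem_coe, Fintype.mem_piFinset]
    constructor
    · intro h i
      by_cases hi : i = j
      · subst hi; simp [h]
      · simp [hi]
    · intro h
      simpa using h j
  rw [this, Set.ncard_coe_finset, Fintype.card_piFinset]
  simp [apply_ite, Finset.prod_ite, Finset.filter_ne']

/-- There is a Ruzsa–Szemerédi graph with `T` induced matchings of nearly `n / 2` edges, in which
every vertex is missed by some matching. On the Boolean cube, the `j`-th matching joins `x` with
`x j = 0` to the vector `y` with `y j = 0` that differs from `x` in all other coordinates; so
no edge of the `j`-th matching has both ends in `{x | x i = 0}` for `i ≠ j`. Each vertex of one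
cube may lie in all of the matchings, so copies of the cube come in groups of `T`, the `s`-th
copy of a group being left out of the `s`-th matching. -/
theorem exists_ruzsaSzemerediGraph (n T : ℕ) (hT : 0 < T) :
    ∃ R : RuzsaSzemerediGraph n (n / (T * 2 ^ T) * ((T - 1) * 2 ^ (T - 1))) T,
      ∀ v, ∃ i, v ∉ (R.matching i).verts := by
  set q := n / (T * 2 ^ T) with hq
  have hcardC : Fintype.card (Fin q × Fin T × (Fin T → Bool)) ≤ Fintype.card (Fin n) := by
    simpa [hq] using Nat.div_mul_le_self n (T * 2 ^ T)
  obtain ⟨f⟩ := Function.Embedding.nonempty_of_card_le hcardC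
  let g : Fin T → Fin q × Fin T × (Fin T → Bool) → Fin q × Fin T × (Fin T → Bool) :=
    fun j x => (x.1, x.2.1, flipExcept j x.2.2)
  have hg : ∀ j, Function.Injective (g j) := by
    rintro j ⟨c, s, x⟩ ⟨c', s', x'⟩ h
    simp only [g, Prod.mk.injEq] at h
    obtain ⟨rfl, rfl, h⟩ := h
    rw [flipExcept_injective j h]
  let A : Fin T → Set (Fin q × Fin T × (Fin T → Bool)) :=
    fun j => Set.univ ×ˢ ({j}ᶜ ×ˢ {x | x j = false})
  have hA : ∀ j x, x ∈ A j ↔ x.2.1 ≠ j ∧ x.2.2 j = false := by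
    intro j x
    simp [A]
  let m : Fin T → Fin n → Fin n → Prop := fun j a b => ∃ x ∈ A j, f x = a ∧ f (g j x) = b
  have hcard : ∀ j, {x : Fin n × Fin n | m j x.1 x.2}.ncard =
      q * ((T - 1) * 2 ^ (T - 1)) := by
    intro j
    have himage : {x : Fin n × Fin n | m j x.1 x.2} = (fun x => (f x, f (g j x))) '' A j := by
      ext ⟨a, b⟩
      simp [m]
    rw [himage, Set.ncard_image_of_injective _ fun x y h => f.injective (Prod.mk.inj h).1,
      Set.ncard_prod, Set.ncard_prod, ncard_apply_eq_false, Set.ncard_compl]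
    simp
  refine ⟨RuzsaSzemerediGraph.ofRel m ?_ ?_ ?_ hcard, ?_⟩
  · rintro j a b b' ⟨x, -, rfl, rfl⟩ ⟨x', -, hx', rfl⟩
    rw [f.injective hx']
  · rintro j a a' b ⟨x, -, rfl, rfl⟩ ⟨x', -, rfl, hx'⟩
    rw [hg j (f.injective hx')]
  · rintro i j a b a' b' ⟨x, hx, rfl, rfl⟩ ⟨y, hy, hyx, -⟩ ⟨z, hz, -, hzx⟩
    obtain rfl := f.injective hyx
    have h := congrArg (fun x : Fin q × Fin T × (Fin T → Bool) => x.2.2 i) (f.injective hzx)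
    by_contra hij
    simp only [g, flipExcept_self, flipExcept_of_ne hij, ((hA i y).1 hy).2,
      ((hA i z).1 hz).2] at h
    simp at h
  · have hmiss : ∀ x : Fin q × Fin T × (Fin T → Bool), x ∉ A x.2.1 := by
      intro x hx
      exact ((hA _ _).1 hx).1 rfl
    rintro (v | v)
    · by_cases hv : ∃ x, f x = v
      · obtain ⟨x, rfl⟩ := hv
        refine ⟨x.2.1, ?_⟩
        rintro ⟨w | w, hw⟩
        · exact hw
        · obtain ⟨y, hy, hyx, -⟩ := hw
          rw [f.injective hyx] at hy
          exact hmiss x hy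
      · refine ⟨⟨0, hT⟩, ?_⟩
        rintro ⟨w | w, hw⟩
        · exact hw
        · obtain ⟨y, hy, hyx, -⟩ := hw
          exact hv ⟨y, hyx⟩
    · by_cases hv : ∃ x, f x = v
      · obtain ⟨x, rfl⟩ := hv
        refine ⟨x.2.1, ?_⟩
        rintro ⟨w | w, hw⟩
        · obtain ⟨y, hy, -, hyx⟩ := hw
          have hs : y.2.1 = x.2.1 := congrArg (fun x => x.2.1) (f.injective hyx)
          exact hmiss y (hs ▸ hy)
        · exact hw
      · refine ⟨⟨0, hT⟩, ?_⟩
        rintro ⟨w | w, hw⟩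
        · obtain ⟨y, hy, -, hyx⟩ := hw
          exact hv ⟨_, hyx⟩
        · exact hw

/-! ### Non-adaptive algorithms with few queries -/

/-- A union bound over the `m`-element subsets of `M`. -/
theorem bernoulliSubgraph_toOuterMeasure_le_ncard_inter {W : Type} [Fintype W]
    (G : SimpleGraph W) (p : ℝ≥0) (hp : p ≤ 1) {M : Set (Sym2 W)} (hM : M ⊆ G.edgeSet) (m : ℕ) :
    (bernoulliSubgraph G p hp).toOuterMeasure {K | m ≤ (K.edgeSet ∩ M).ncard} ≤
      2 ^ M.ncard * (p : ℝ≥0∞) ^ m := by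
  classical
  have hsub : {K : SimpleGraph W | m ≤ (K.edgeSet ∩ M).ncard} ⊆
      ⋃ U ∈ M.toFinite.toFinset.powersetCard m, {K : SimpleGraph W | ∀ e ∈ U, e ∈ K.edgeSet} := by
    intro K hK
    have hK' : m ≤ (K.edgeSet ∩ M).toFinite.toFinset.card := by
      rw [← Set.ncard_eq_toFinset_card]
      exact hK
    obtain ⟨U, hU, hUm⟩ := Finset.exists_subset_card_eq hK'
    rw [Set.mem_iUnion₂]
    refine ⟨U, Finset.mem_powersetCard.2 ⟨fun e he => ?_, hUm⟩, fun e he => ?_⟩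
    · have := hU he
      rw [Set.Finite.mem_toFinset] at this ⊢
      exact this.2
    · have := hU he
      rw [Set.Finite.mem_toFinset] at this
      exact this.1
  have hU : ∀ U ∈ M.toFinite.toFinset.powersetCard m,
      (bernoulliSubgraph G p hp).toOuterMeasure {K | ∀ e ∈ U, e ∈ K.edgeSet} =
        (p : ℝ≥0∞) ^ m := by
    intro U hU
    rw [Finset.mem_powersetCard] at hU
    rw [bernoulliSubgraph_toOuterMeasure_superset, hU.2]
    intro e he
    exact hM (by simpa using hU.1 he)
  refine (MeasureTheory.measure_mono hsub).trans
    ((MeasureTheory.measure_biUnion_finset_le _ _).trans ?_)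
  rw [Finset.sum_congr rfl hU, Finset.sum_const, Finset.card_powersetCard,
    ← Set.ncard_eq_toFinset_card, nsmul_eq_mul]
  gcongr
  exact_mod_cast Nat.choose_le_two_pow _ _

theorem RuzsaSzemerediGraph.sum_ncard_queries_le {n r t : ℕ} (R : RuzsaSzemerediGraph n r t)
    (Q : Finset (Sym2 ((Fin n ⊕ Fin n) ⊕ (Fin n ⊕ Fin n)))) :
    ∑ i, ((R.matching i).edgeSet ∩ {e | e.map Sum.inl ∈ Q}).ncard ≤ Q.card := by
  classical
  have hinj : Function.Injective (Sym2.map (Sum.inl : Fin n ⊕ Fin n →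
      (Fin n ⊕ Fin n) ⊕ (Fin n ⊕ Fin n))) := Sym2.map.injective Sum.inl_injective
  have hcard : ∀ i, ((R.matching i).edgeSet ∩ {e | e.map Sum.inl ∈ Q}).ncard =
      (((R.matching i).edgeSet ∩ {e | e.map Sum.inl ∈ Q}).toFinite.toFinset.image
        (Sym2.map (Sum.inl : Fin n ⊕ Fin n → (Fin n ⊕ Fin n) ⊕ (Fin n ⊕ Fin n)))).card := by
    intro i
    rw [Finset.card_image_of_injective _ hinj, ← Set.ncard_eq_toFinset_card]
  rw [Finset.sum_congr rfl fun i _ => hcard i, ← Finset.card_biUnion]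
  · refine Finset.card_le_card fun f hf => ?_
    simp only [Finset.mem_biUnion, Finset.mem_image, Set.Finite.mem_toFinset] at hf
    obtain ⟨i, -, e, he, rfl⟩ := hf
    exact he.2
  · intro i _ j _ hij
    rw [Function.onFun, Finset.disjoint_left]
    intro f hi hj
    simp only [Finset.mem_image, Set.Finite.mem_toFinset] at hi hj
    obtain ⟨e, he, rfl⟩ := hi
    obtain ⟨e', he', hee'⟩ := hj
    obtain rfl := hinj hee'
    exact Set.disjoint_left.1 (R.disjoint_matching i j hij) he.1 he'.1

/-- The two estimates of cover sizes, with `x` core vertices outside of `M*`, `a` queried and `b`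
realized edges of `M*`, give the approximation ratio when `a` and `b` are at most `n / k`. -/
theorem ratio_mul_le_of_cover_bounds {ε : ℝ} {k n r x a b S c : ℕ}
    (hε : 5 / k ≤ ε) (hk10 : 10 ≤ k) (hr : (n : ℝ) / 2 - n / k ≤ r) (hx : x + 2 * r ≤ 2 * n)
    (ha : k * a ≤ n) (hb : k * b ≤ n) (hS : x + r ≤ S + a) (hc : c ≤ x + b) :
    (3 / 2 - ε) * (c : ℝ) ≤ S := by
  have hk' : (0 : ℝ) < k := by
    have : 0 < k := by omega
    exact_mod_cast this
  have hε' : 5 / (k : ℝ) ≤ 1 / 2 := by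
    rw [div_le_iff₀ hk']
    have : (10 : ℝ) ≤ k := by exact_mod_cast hk10
    linarith
  have ha' : (a : ℝ) ≤ n / k := by
    rw [le_div_iff₀ hk', mul_comm]
    exact_mod_cast ha
  have hb' : (b : ℝ) ≤ n / k := by
    rw [le_div_iff₀ hk', mul_comm]
    exact_mod_cast hb
  have hx' : (x : ℝ) + 2 * r ≤ 2 * n := by exact_mod_cast hx
  have hS' : (x : ℝ) + r ≤ S + a := by exact_mod_cast hS
  have hc' : (c : ℝ) ≤ x + b := by exact_mod_cast hc
  have hdiv : 5 / (k : ℝ) * n = 5 * (n / k) := by ring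
  have hd0 : (0 : ℝ) ≤ n / k := by positivity
  have hk0 : (0 : ℝ) ≤ 5 / k := by positivity
  calc (3 / 2 - ε) * (c : ℝ) ≤ (3 / 2 - 5 / k) * (c : ℝ) := by gcongr
    _ ≤ (3 / 2 - 5 / k) * (x + n / k) := by
        have : (0 : ℝ) ≤ 3 / 2 - 5 / k := by linarith
        gcongr
        linarith
    _ = x + (1 / 2 - 5 / k) * x + (3 / 2 - 5 / k) * (n / k) := by ring
    _ ≤ x + (1 / 2 - 5 / k) * (n + 2 * (n / k)) + 3 / 2 * (n / k) := by
        have : (0 : ℝ) ≤ 1 / 2 - 5 / k := by linarith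
        gcongr
        · linarith
        · linarith
    _ ≤ S := by nlinarith [mul_nonneg hk0 hd0]

namespace RuzsaSzemerediGraph

variable {n r t : ℕ} (R : RuzsaSzemerediGraph n r t)

/-- The chosen matching has more than `n / k` queried edges with probability at most
`k |Q| / (n t)`, by Markov's inequality. -/
theorem sum_inv_mul_ite_lt_ncard_queries_le (hn : 0 < n) (k : ℕ)
    (Q : Finset (Sym2 ((Fin n ⊕ Fin n) ⊕ (Fin n ⊕ Fin n)))) :
    ∑ i, (t : ℝ≥0∞)⁻¹ *
        (if k * ((R.matching i).edgeSet ∩ {e | e.map Sum.inl ∈ Q}).ncard ≤ n then 0 else 1) ≤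
      (Q.card : ℝ≥0∞) * (k * (t : ℝ≥0∞)⁻¹ * (n : ℝ≥0∞)⁻¹) := by
  have hn0 : (n : ℝ≥0∞) ≠ 0 := by exact_mod_cast hn.ne'
  calc _ ≤ ∑ i, (t : ℝ≥0∞)⁻¹ *
        (((k * ((R.matching i).edgeSet ∩ {e | e.map Sum.inl ∈ Q}).ncard : ℕ) : ℝ≥0∞) *
          (n : ℝ≥0∞)⁻¹) := by
        gcongr with i
        split_ifs with h
        · exact zero_le
        · rw [← ENNReal.mul_inv_cancel hn0 (ENNReal.natCast_ne_top n)]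
          gcongr
          exact_mod_cast (not_le.1 h).le
    _ = ((∑ i, ((R.matching i).edgeSet ∩ {e | e.map Sum.inl ∈ Q}).ncard : ℕ) : ℝ≥0∞) *
          (k * (t : ℝ≥0∞)⁻¹ * (n : ℝ≥0∞)⁻¹) := by
        rw [Nat.cast_sum, Finset.sum_mul]
        refine Finset.sum_congr rfl fun i _ => ?_
        push_cast
        ring
    _ ≤ _ := by
        gcongr
        exact R.sum_ncard_queries_le Q

variable [NeZero t]

/-- For a fixed choice of `M*` of which at most `n / k` edges are queried, the ratio is attained
unless `n / k` edges of `M*` are realized, which is unlikely for `p = 4 ^ (-k)`. -/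
theorem one_le_toOuterMeasure_ratio_add {ε : ℝ} {k : ℕ} (hk10 : 10 ≤ k) (hε : 5 / k ≤ ε)
    (hr : (n : ℝ) / 2 - n / k ≤ r) {p : ℝ≥0} (hp : p ≤ 1) (hpk : p = (1 / 4) ^ k)
    {a : NonAdaptiveAlgorithm ((Fin n ⊕ Fin n) ⊕ (Fin n ⊕ Fin n))}
    (ha : ∀ H ∈ (R.toStochasticGraph p hp).law.support, H.IsVertexCover (a.run H : Set _))
    (i : Fin t)
    (hi : k * ((R.matching i).edgeSet ∩ {e | e.map Sum.inl ∈ a.queries}).ncard ≤ n) :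
    1 ≤ (bernoulliSubgraph R.graph p hp).toOuterMeasure
        {K | (3 / 2 - ε) *
            ((withExterior K (R.matching i).vertsᶜ).vertexCoverNum.toNat : ℝ) ≤
          ((a.run (withExterior K (R.matching i).vertsᶜ)).card : ℝ)} +
      (2 ^ n : ℝ≥0∞)⁻¹ := by
  have hk : 0 < k := by omega
  have hp0 : 0 < p := by rw [hpk]; positivity
  have hp1 : p < 1 := by
    rw [hpk]
    refine pow_lt_one₀ (by positivity) ?_ (by omega)
    rw [div_lt_one (by norm_num)]
    norm_num
  have hrn : r ≤ n := by
    have := R.ncard_compl_verts_add_le i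
    omega
  set m := n ⌈/⌉ k with hm
  have hnm : n ≤ k * m := by simpa using le_smul_ceilDiv (b := n) hk
  have hsmall : (2 : ℝ≥0∞) ^ r * (p : ℝ≥0∞) ^ m ≤ (2 ^ n : ℝ≥0∞)⁻¹ := by
    have h : (2 : ℝ≥0) ^ r * p ^ m ≤ (2 ^ n)⁻¹ := by
      calc (2 : ℝ≥0) ^ r * p ^ m ≤ 2 ^ n * (1 / 4) ^ n := by
            rw [hpk, ← pow_mul]
            have h4 : (1 / 4 : ℝ≥0) ≤ 1 := by
              rw [div_le_one (by norm_num)]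
              norm_num
            exact mul_le_mul' (pow_le_pow_right₀ (by norm_num) hrn)
              (pow_le_pow_of_le_one zero_le h4 hnm)
        _ = (2 ^ n)⁻¹ := by
            rw [← mul_pow, ← inv_pow]
            congr 1
            rw [← NNReal.coe_inj]
            norm_num
    have h' := ENNReal.coe_le_coe.2 h
    rw [ENNReal.coe_inv (by positivity)] at h'
    push_cast at h'
    exact h'
  have hmany := bernoulliSubgraph_toOuterMeasure_le_ncard_inter R.graph p hp
    (R.matching i).edgeSet_subset m
  rw [R.card_matching i] at hmany
  refine le_trans ?_ (add_le_add_right (hmany.trans hsmall) _)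
  refine le_trans (Eq.ge ?_) (MeasureTheory.measure_union_le _ _)
  rw [PMF.toOuterMeasure_apply_eq_one_iff]
  intro K hK
  have hKR := le_of_mem_support_bernoulliSubgraph hK
  by_cases hKm : m ≤ (K.edgeSet ∩ (R.matching i).edgeSet).ncard
  · exact Or.inr hKm
  · left
    have hb : k * (K.edgeSet ∩ (R.matching i).edgeSet).ncard ≤ n := by
      by_contra hlt
      exact hKm ((ceilDiv_le_iff_le_smul hk).2 (by simpa using (not_le.1 hlt).le))
    exact ratio_mul_le_of_cover_bounds hε hk10 hr (R.ncard_compl_verts_add_le i) hi hb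
      (R.ncard_compl_verts_add_le_card_run hp hp0 hp1 ha hKR i)
      (R.vertexCoverNum_withExterior_le hKR i)

theorem one_le_probRatioAtLeast_add {ε : ℝ} {k : ℕ} (hk10 : 10 ≤ k) (hε : 5 / k ≤ ε)
    (hn : 0 < n) (hr : (n : ℝ) / 2 - n / k ≤ r) {p : ℝ≥0} (hp : p ≤ 1)
    (hpk : p = (1 / 4) ^ k) {C : ℕ}
    {A : RandomizedNonAdaptiveAlgorithm ((Fin n ⊕ Fin n) ⊕ (Fin n ⊕ Fin n))}
    (hA : A.SolvesVertexCover (R.toStochasticGraph p hp))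
    (hC : A.expectedQueries ≤ (C : ℝ≥0∞) * (n : ℝ≥0∞)) :
    1 ≤ A.probRatioAtLeast (R.toStochasticGraph p hp) (3 / 2 - ε) +
      (C * k * (t : ℝ≥0∞)⁻¹ + (2 ^ n : ℝ≥0∞)⁻¹) := by
  set g : NonAdaptiveAlgorithm ((Fin n ⊕ Fin n) ⊕ (Fin n ⊕ Fin n)) → ℝ≥0∞ := fun a =>
    (R.toStochasticGraph p hp).law.toOuterMeasure
      {H | (3 / 2 - ε) * (H.vertexCoverNum.toNat : ℝ) ≤ ((a.run H).card : ℝ)} with hg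
  have hprob : A.probRatioAtLeast (R.toStochasticGraph p hp) (3 / 2 - ε) = ∑' a, A a * g a := by
    rw [RandomizedNonAdaptiveAlgorithm.probRatioAtLeast, PMF.toOuterMeasure_bind_apply]
    refine tsum_congr fun a => ?_
    rw [PMF.toOuterMeasure_map_apply]
    rfl
  have hfix : ∀ a ∈ A.support, 1 ≤ g a +
      (a.queries.card * (k * (t : ℝ≥0∞)⁻¹ * (n : ℝ≥0∞)⁻¹) + (2 ^ n : ℝ≥0∞)⁻¹) := by
    intro a ha
    have hsum : 1 ≤ g a + (∑ i, (t : ℝ≥0∞)⁻¹ *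
        (if k * ((R.matching i).edgeSet ∩ {e | e.map Sum.inl ∈ a.queries}).ncard ≤ n
          then 0 else 1) + (2 ^ n : ℝ≥0∞)⁻¹) := by
      have hconst : (2 ^ n : ℝ≥0∞)⁻¹ = ∑ _i : Fin t, (t : ℝ≥0∞)⁻¹ * (2 ^ n : ℝ≥0∞)⁻¹ := by
        rw [← Finset.sum_mul, sum_inv_card_eq_one, one_mul]
      simp only [hg]
      rw [toOuterMeasure_law, hconst, ← Finset.sum_add_distrib, ← Finset.sum_add_distrib]
      refine (sum_inv_card_eq_one (t := t)).ge.trans (Finset.sum_le_sum fun i _ => ?_)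
      rw [← mul_add, ← mul_add]
      refine le_mul_of_one_le_right zero_le ?_
      split_ifs with hi
      · rw [zero_add]
        exact R.one_le_toOuterMeasure_ratio_add hk10 hε hr hp hpk (hA a ha) i hi
      · exact le_add_left le_self_add
    refine hsum.trans ?_
    gcongr
    exact R.sum_inv_mul_ite_lt_ncard_queries_le hn k a.queries
  have hn0 : (n : ℝ≥0∞) ≠ 0 := by exact_mod_cast hn.ne'
  calc (1 : ℝ≥0∞) = ∑' a, A a := A.tsum_coe.symm
    _ ≤ ∑' a, (A a * g a + (A a * a.queries.card * (k * (t : ℝ≥0∞)⁻¹ * (n : ℝ≥0∞)⁻¹) +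
          A a * (2 ^ n : ℝ≥0∞)⁻¹)) := by
        refine ENNReal.tsum_le_tsum fun a => ?_
        by_cases ha : a ∈ A.support
        · calc A a ≤ A a * (g a + (a.queries.card * (k * (t : ℝ≥0∞)⁻¹ * (n : ℝ≥0∞)⁻¹) +
                (2 ^ n : ℝ≥0∞)⁻¹)) := le_mul_of_one_le_right zero_le (hfix a ha)
            _ = _ := by ring
        · rw [PMF.mem_support_iff, not_not] at ha
          rw [ha]
          exact zero_le
    _ = A.probRatioAtLeast (R.toStochasticGraph p hp) (3 / 2 - ε) +
          (A.expectedQueries * (k * (t : ℝ≥0∞)⁻¹ * (n : ℝ≥0∞)⁻¹) + (2 ^ n : ℝ≥0∞)⁻¹) := by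
        rw [ENNReal.tsum_add, ENNReal.tsum_add, ENNReal.tsum_mul_right, ENNReal.tsum_mul_right,
          A.tsum_coe, one_mul, hprob]
        rfl
    _ ≤ A.probRatioAtLeast (R.toStochasticGraph p hp) (3 / 2 - ε) +
          (C * n * (k * (t : ℝ≥0∞)⁻¹ * (n : ℝ≥0∞)⁻¹) + (2 ^ n : ℝ≥0∞)⁻¹) := by gcongr
    _ = _ := by
        congr 2
        calc (C : ℝ≥0∞) * n * (k * (t : ℝ≥0∞)⁻¹ * (n : ℝ≥0∞)⁻¹) =
              C * k * (t : ℝ≥0∞)⁻¹ * (n * (n : ℝ≥0∞)⁻¹) := by ring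
          _ = _ := by rw [ENNReal.mul_inv_cancel hn0 (ENNReal.natCast_ne_top n), mul_one]

end RuzsaSzemerediGraph

/-! ### The choice of parameters -/

/-- With `T = ⌊log₈ n⌋ + 1` matchings, their size is at least `n / 2 - 5 n / T`. -/
theorem half_sub_le_matching_size (n : ℕ) (hn : 0 < n) :
    (n : ℝ) / 2 - 5 * n / ((Nat.log 8 n + 1 : ℕ) : ℝ) ≤
      ((n / ((Nat.log 8 n + 1) * 2 ^ (Nat.log 8 n + 1)) *
        ((Nat.log 8 n + 1 - 1) * 2 ^ (Nat.log 8 n + 1 - 1)) : ℕ) : ℝ) := by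
  set L := Nat.log 8 n with hL
  set N := (L + 1) * 2 ^ (L + 1) with hN
  have h8 : 8 ^ L ≤ n := Nat.pow_log_le_self 8 hn.ne'
  have hlin : L + 1 ≤ 2 ^ L := Nat.lt_two_pow_self
  -- The rounding loss `N` is at most `8 n / (L + 1)`.
  have hNn : N * (L + 1) ≤ 8 * n := by
    calc N * (L + 1) = (L + 1) * (L + 1) * 2 ^ L * 2 := by rw [hN, pow_succ]; ring
      _ ≤ 2 ^ L * 2 ^ L * 2 ^ L * 2 := by gcongr
      _ = 8 ^ L * 2 := by rw [show (8 : ℕ) = 2 * 2 * 2 from rfl, mul_pow, mul_pow]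
      _ ≤ 8 * n := by omega
  have hdiv : n < (n / N + 1) * N := by
    have := Nat.lt_mul_div_succ n (show 0 < N by positivity)
    rwa [mul_comm] at this
  rw [Nat.add_sub_cancel]
  have hT : (0 : ℝ) < ((L + 1 : ℕ) : ℝ) := by positivity
  have hNn' : (N : ℝ) * ((L + 1 : ℕ) : ℝ) ≤ 8 * n := by exact_mod_cast hNn
  have hdiv' : (n : ℝ) - N ≤ (n / N : ℕ) * (N : ℝ) := by
    have : (n : ℝ) < ((n / N : ℕ) + 1) * (N : ℝ) := by exact_mod_cast hdiv
    linarith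
  have hle : ((n / N : ℕ) : ℝ) * N ≤ n := by exact_mod_cast Nat.div_mul_le_self n N
  have hval : ((n / N * (L * 2 ^ L) : ℕ) : ℝ) * ((L + 1 : ℕ) : ℝ) =
      ((n / N : ℕ) : ℝ) * N * L / 2 := by
    rw [hN]
    push_cast
    ring
  rw [← mul_le_mul_iff_of_pos_right hT, hval, sub_mul, div_mul_cancel₀ _ hT.ne']
  push_cast at hNn' ⊢
  have hL0 : (0 : ℝ) ≤ L := by positivity
  have hN0 : (0 : ℝ) ≤ N := by positivity
  nlinarith [mul_le_mul_of_nonneg_right hdiv' hL0]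

theorem tendsto_log_add_one_atTop : Tendsto (fun n : ℕ => Nat.log 8 n + 1) atTop atTop := by
  refine tendsto_atTop.2 fun b => ?_
  filter_upwards [eventually_ge_atTop (8 ^ b)] with n hn
  exact (Nat.le_log_of_pow_le (by norm_num) hn).trans (Nat.le_succ _)

theorem mainTheorem3 (ε : ℝ) (hε : 0 < ε) :
    ∃ (p : ℝ≥0) (hp : p ≤ 1) (r t : ℕ → ℕ) (_ : ∀ n, NeZero (t n))
      (R : ∀ n, RuzsaSzemerediGraph n (r n) (t n)),
      0 < p ∧
      (∀ n, ∀ e ∈ ((R n).toStochasticGraph p hp).graph.edgeSet,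
        0 < ((R n).toStochasticGraph p hp).edgeProb e) ∧
      (∃ K : ℕ, ∀ n, ((R n).toStochasticGraph p hp).MildlyCorrelated K) ∧
      ∀ C : ℕ, ∃ η : ℕ → ℝ, Tendsto η atTop (𝓝 0) ∧
        ∀ (n : ℕ) (A : RandomizedNonAdaptiveAlgorithm ((Fin n ⊕ Fin n) ⊕ (Fin n ⊕ Fin n))),
          A.SolvesVertexCover ((R n).toStochasticGraph p hp) →
          A.expectedQueries ≤ (C : ℝ≥0∞) * (n : ℝ≥0∞) →
          ENNReal.ofReal (1 - η n) ≤
            A.probRatioAtLeast ((R n).toStochasticGraph p hp) (3 / 2 - ε) := by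
  classical
  -- The tolerance `n / k` for queried and for realized edges of `M*` costs `5 / k` in the ratio.
  obtain ⟨k, hk10, hkε⟩ : ∃ k : ℕ, 10 ≤ k ∧ 5 / (k : ℝ) ≤ ε := by
    obtain ⟨k, hk⟩ := exists_nat_ge (5 / ε)
    refine ⟨k + 10, by omega, ?_⟩
    rw [div_le_iff₀ hε] at hk
    rw [div_le_iff₀ (by positivity)]
    push_cast
    nlinarith
  have hp : ((1 / 4 : ℝ≥0)) ^ k ≤ 1 :=
    pow_le_one₀ (by positivity) (by rw [div_le_one (by norm_num)]; norm_num)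
  choose R hR using fun n => exists_ruzsaSzemerediGraph n (Nat.log 8 n + 1) (Nat.succ_pos _)
  have hne : ∀ n, NeZero (Nat.log 8 n + 1) := fun n => ⟨Nat.succ_ne_zero _⟩
  refine ⟨(1 / 4) ^ k, hp, _, _, hne, R, by positivity,
    fun n e he => (R n).edgeProb_pos _ hp (by positivity) (hR n) he,
    ⟨1, fun n => (R n).mildlyCorrelated _ hp⟩, fun C => ?_⟩
  set η : ℕ → ℝ≥0 := fun n => C * k * ((Nat.log 8 n + 1 : ℕ) : ℝ≥0)⁻¹ + (2 ^ n)⁻¹ with hη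
  -- For the finitely many small `n`, where the matchings are too small, `η n = 1` claims nothing.
  refine ⟨fun n => if 0 < n ∧ 5 * k ≤ Nat.log 8 n + 1 then (η n : ℝ) else 1, ?_, ?_⟩
  · have hlim : Tendsto (fun n => (η n : ℝ)) atTop (𝓝 0) := by
      have h1 : Tendsto (fun n => (((Nat.log 8 n + 1 : ℕ) : ℝ))⁻¹) atTop (𝓝 0) :=
        tendsto_inv_atTop_zero.comp
          (tendsto_natCast_atTop_atTop.comp tendsto_log_add_one_atTop)
      have h2 : Tendsto (fun n : ℕ => ((2 : ℝ) ^ n)⁻¹) atTop (𝓝 0) :=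
        tendsto_inv_atTop_zero.comp (tendsto_pow_atTop_atTop_of_one_lt (by norm_num))
      simpa [hη] using (h1.const_mul ((C : ℝ) * k)).add h2
    refine hlim.congr' ?_
    filter_upwards [eventually_gt_atTop 0,
      tendsto_log_add_one_atTop.eventually_ge_atTop (5 * k)] with n hn hkn
    rw [if_pos ⟨hn, hkn⟩]
  · intro n A hA hC
    dsimp only
    split_ifs with h
    · have hr : (n : ℝ) / 2 - n / k ≤ _ := le_trans ?_ (half_sub_le_matching_size n h.1)
      · have hmain := (R n).one_le_probRatioAtLeast_add hk10 hkε h.1 hr hp rfl hA hC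
        have hηn : (C * k * ((Nat.log 8 n + 1 : ℕ) : ℝ≥0∞)⁻¹ + (2 ^ n : ℝ≥0∞)⁻¹) =
            (η n : ℝ≥0∞) := by
          rw [hη, ENNReal.coe_add, ENNReal.coe_mul, ENNReal.coe_inv (by positivity),
            ENNReal.coe_inv (by positivity)]
          push_cast
          rfl
        rw [hηn] at hmain
        rw [ENNReal.ofReal_sub _ (η n).coe_nonneg, ENNReal.ofReal_one, ENNReal.ofReal_coe_nnreal]
        exact tsub_le_iff_right.2 hmain
      · have hk0 : (0 : ℝ) < k := by
          have : 0 < k := by omega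
          exact_mod_cast this
        have hkL : 5 * (k : ℝ) ≤ ((Nat.log 8 n + 1 : ℕ) : ℝ) := by exact_mod_cast h.2
        have : 5 * (n : ℝ) / ((Nat.log 8 n + 1 : ℕ) : ℝ) ≤ n / k := by
          rw [div_le_div_iff₀ (by positivity) hk0]
          nlinarith [mul_le_mul_of_nonneg_left hkL (Nat.cast_nonneg (α := ℝ) n)]
        linarith
    · simp
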